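/- A skew brace is a set $A$ with two binary operations $+$ and $\circ$ such that $(A,+)$ and $(A,\circ)$ are (not necessarily abelian) groups and $a\circ(b+c)=a\circ b-a+a\circ c$ for all $a,b,c\in A$, where $-a$ is the inverse of $a$ in $(A,+)$ and $\circ$ has precedence over $+$. It is two-sided if moreover $(a+b)\circ c=a\circ c-c+b\circ c$ for all $a,b,c\in A$. A group satisfies the maximum condition on subgroups if it has no infinite strictly ascending chain of subgroups. Theorem. Let $A$ be a two-sided skew brace. Then the following are equivalent: (1) the additive group $(A,+)$ satisfies the maximum condition on subgroups; (2) the multiplicative group $(A,\circ)$ satisfies the maximum condition on subgroups. -/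

import Mathlib

/-- A skew (left) brace: a set with two group structures, the additive group `(A, +)` (not
necessarily commutative) and the multiplicative group `(A, ∘)`, written here with `*`,
such that `a ∘ (b + c) = a ∘ b - a + a ∘ c`. -/
class IsSkewBrace (A : Type*) [AddGroup A] [Group A] : Prop where
  mul_add_eq : ∀ a b c : A, a * (b + c) = a * b - a + a * c

/-- A two-sided skew brace: a skew brace with also `(a + b) ∘ c = a ∘ c - c + b ∘ c`. -/
class IsTwoSidedSkewBrace (A : Type*) [AddGroup A] [Group A] : Prop extends IsSkewBrace A where
  add_mul_eq : ∀ a b c : A, (a + b) * c = a * c - c + b * c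

/-- The maximum condition on subgroups: there is no infinite strictly ascending chain
`H 0 < H 1 < H 2 < ⋯` of subgroups. -/
def MaxConditionOnSubgroups (G : Type*) [Group G] : Prop :=
  ¬ ∃ H : ℕ → Subgroup G, StrictMono H

/-- The maximum condition on subgroups, for a group written additively. -/
def MaxConditionOnAddSubgroups (G : Type*) [AddGroup G] : Prop :=
  ¬ ∃ H : ℕ → AddSubgroup G, StrictMono H

section Order

/-- Subgroups below `M` satisfy the ascending chain condition iff those below a normal subgroup
`K ≤ M` and those between `K` and `M` do. -/
@[to_additive]
theorem Subgroup.wellFoundedGT_Iic_iff {G : Type*} [Group G] {K M : Subgroup G}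
    (hK : ∀ g, ∀ k ∈ K, g * k * g⁻¹ ∈ K) (hKM : K ≤ M) :
    WellFoundedGT (Set.Iic M) ↔ WellFoundedGT (Set.Iic K) ∧ WellFoundedGT (Set.Icc K M) := by
  have : K.Normal := ⟨fun n hn g => hK g n hn⟩
  constructor
  · intro h
    refine ⟨StrictMono.wellFoundedGT (β := Set.Iic M) (f := fun H => ⟨H.1, H.2.trans hKM⟩) ?_,
      StrictMono.wellFoundedGT (β := Set.Iic M) (f := fun H => ⟨H.1, H.2.2⟩) ?_⟩ <;>
    exact fun _ _ h => h
  · rintro ⟨h1, h2⟩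
    refine StrictMono.wellFoundedGT (β := Set.Iic K × Set.Icc K M)
      (f := fun H => (⟨H.1 ⊓ K, Set.mem_Iic.2 inf_le_right⟩, ⟨H.1 ⊔ K, le_sup_right, sup_le H.2 hKM⟩)) ?_
    intro H H' hlt
    have hle : H.1 ≤ H'.1 := hlt.le
    refine lt_of_le_of_ne ⟨inf_le_inf_right _ hle, sup_le_sup_right hle _⟩ ?_
    intro heq
    have e1 : H.1 ⊓ K = H'.1 ⊓ K := congrArg (fun p => p.1.1) heq
    have e2 : H.1 ⊔ K = H'.1 ⊔ K := congrArg (fun p => p.2.1) heq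
    refine hlt.not_ge ?_
    intro x hx
    have hx2 : x ∈ H.1 ⊔ K := e2 ▸ (le_sup_left (b := K) hx)
    obtain ⟨y, hy, k, hk, rfl⟩ := Subgroup.mem_sup_of_normal_right.1 hx2
    have hkH : k ∈ H'.1 := (Subgroup.mul_mem_cancel_left _ (hle hy)).1 hx
    have : k ∈ H.1 ⊓ K := e1 ▸ ⟨hkH, hk⟩
    exact mul_mem hy this.1

@[to_additive]
theorem Subgroup.exists_finite_closure_eq {G : Type*} [Group G] [WellFoundedGT (Subgroup G)]
    (H : Subgroup G) : ∃ S : Set G, S.Finite ∧ Subgroup.closure S = H := by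
  obtain ⟨P, ⟨S, hS, hSH, rfl⟩, hmax⟩ := wellFounded_gt.has_min
    {P : Subgroup G | ∃ S : Set G, S.Finite ∧ S ⊆ H ∧ Subgroup.closure S = P}
    ⟨_, ∅, Set.finite_empty, Set.empty_subset _, rfl⟩
  refine ⟨S, hS, le_antisymm ((Subgroup.closure_le H).2 hSH) fun x hx => ?_⟩
  by_contra hxS
  refine hmax _ ⟨insert x S, hS.insert x, Set.insert_subset hx hSH, rfl⟩ ?_
  refine lt_of_le_of_ne (Subgroup.closure_mono (Set.subset_insert _ _)) fun h => hxS ?_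
  rw [h]
  exact Subgroup.subset_closure (Set.mem_insert _ _)

@[to_additive]
theorem Subgroup.wellFoundedGT_Iic_top_iff {G : Type*} [Group G] :
    WellFoundedGT (Set.Iic (⊤ : Subgroup G)) ↔ WellFoundedGT (Subgroup G) :=
  ⟨fun _ => StrictMono.wellFoundedGT (β := Set.Iic (⊤ : Subgroup G)) (f := fun H => ⟨H, Set.mem_Iic.2 le_top⟩)
    fun _ _ h => h, fun _ => inferInstance⟩

@[to_additive]
theorem Subgroup.wellFoundedGT_subtype_iff {G : Type*} [Group G] (K : Subgroup G) :
    WellFoundedGT (Subgroup K) ↔ WellFoundedGT (Set.Iic K) :=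
  ⟨fun _ => StrictMono.wellFoundedGT (α := Set.Iic K) (Subgroup.MapSubtype.orderIso K).symm.strictMono,
    fun _ => StrictMono.wellFoundedGT (β := Set.Iic K) (Subgroup.MapSubtype.orderIso K).strictMono⟩

end Order

theorem maxConditionOnSubgroups_iff (G : Type*) [Group G] :
    MaxConditionOnSubgroups G ↔ WellFoundedGT (Subgroup G) := by
  rw [MaxConditionOnSubgroups]
  constructor
  · intro h
    refine ⟨(RelEmbedding.wellFounded_iff_isEmpty).2 ⟨fun f => h ⟨f, ?_⟩⟩⟩
    exact strictMono_nat_of_lt_succ fun n => f.map_rel_iff.2 (Nat.lt_succ_self n)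
  · rintro h ⟨f, hf⟩
    exact not_strictMono_of_wellFoundedGT f hf

theorem maxConditionOnAddSubgroups_iff (G : Type*) [AddGroup G] :
    MaxConditionOnAddSubgroups G ↔ WellFoundedGT (AddSubgroup G) := by
  rw [MaxConditionOnAddSubgroups]
  constructor
  · intro h
    refine ⟨(RelEmbedding.wellFounded_iff_isEmpty).2 ⟨fun f => h ⟨f, ?_⟩⟩⟩
    exact strictMono_nat_of_lt_succ fun n => f.map_rel_iff.2 (Nat.lt_succ_self n)
  · rintro h ⟨f, hf⟩
    exact not_strictMono_of_wellFoundedGT f hf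

section Layer

variable {A G : Type*} [AddGroup A] [Group G] (e : G ≃ A)

/-- Data making the layer between `N ≤ M` and the layer between `N' ≤ M'` correspond under `e`:
the cosets of `N` and `N'` agree, and on `M` the two operations agree modulo `N`, possibly after
exchanging the factors. -/
structure IsCommonLayer (N M : AddSubgroup A) (N' M' : Subgroup G) : Prop where
  mem_bot : ∀ g, g ∈ N' ↔ e g ∈ N
  mem_top : ∀ g, g ∈ M' ↔ e g ∈ M
  normal : ∀ a, ∀ n ∈ N, a + n + -a ∈ N
  coset : ∀ g, ∀ n ∈ N, ∃ n' ∈ N', e (g * n') = e g + n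
  map_one : e 1 = 0
  compat : (∀ g h, e g ∈ M → e h ∈ M → ∃ n ∈ N, e (g * h) = e g + n + e h) ∨
    (∀ g h, e g ∈ M → e h ∈ M → ∃ n ∈ N, e (g * h) = e h + n + e g)

variable {e} {N M : AddSubgroup A} {N' M' : Subgroup G}

theorem IsCommonLayer.exists_subgroup (h : IsCommonLayer e N M N' M') (H : AddSubgroup A)
    (hN : N ≤ H) (hM : H ≤ M) : ∃ H' : Subgroup G, ∀ g, g ∈ H' ↔ e g ∈ H := by
  have hinv : ∀ g, e g ∈ H → e g⁻¹ ∈ H := by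
    intro g hg
    have hg' : e g⁻¹ ∈ M := (h.mem_top _).1 (inv_mem ((h.mem_top g).2 (hM hg)))
    rcases h.compat with hc | hc
    · obtain ⟨n, hn, hh⟩ := hc g g⁻¹ (hM hg) hg'
      rw [mul_inv_cancel, h.map_one] at hh
      rw [eq_neg_of_add_eq_zero_right hh.symm]
      exact neg_mem (add_mem hg (hN hn))
    · obtain ⟨n, hn, hh⟩ := hc g⁻¹ g hg' (hM hg)
      rw [inv_mul_cancel, h.map_one] at hh
      rw [eq_neg_of_add_eq_zero_right hh.symm]
      exact neg_mem (add_mem hg (hN hn))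
  refine ⟨{ carrier := {g | e g ∈ H}, one_mem' := ?_, mul_mem' := ?_, inv_mem' := ?_ },
    fun g => Iff.rfl⟩
  · intro a b ha hb
    rcases h.compat with hc | hc
    · obtain ⟨n, hn, hh⟩ := hc a b (hM ha) (hM hb)
      exact (congrArg (· ∈ H) hh).mpr (add_mem (add_mem ha (hN hn)) hb)
    · obtain ⟨n, hn, hh⟩ := hc a b (hM ha) (hM hb)
      exact (congrArg (· ∈ H) hh).mpr (add_mem (add_mem hb (hN hn)) ha)
  · exact (congrArg (· ∈ H) h.map_one).mpr (zero_mem H)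
  · intro g hg
    exact hinv g hg

theorem IsCommonLayer.exists_addSubgroup (h : IsCommonLayer e N M N' M') (H' : Subgroup G)
    (hN : N' ≤ H') (hM : H' ≤ M') : ∃ H : AddSubgroup A, ∀ g, g ∈ H' ↔ e g ∈ H := by
  have hco : ∀ g, ∀ n ∈ N, g ∈ H' → e.symm (e g + n) ∈ H' := by
    intro g n hn hg
    obtain ⟨n', hn', hh⟩ := h.coset g n hn
    rw [← hh, e.symm_apply_apply]
    exact mul_mem hg (hN hn')
  have hco' : ∀ a, ∀ n ∈ N, e.symm (a + n) ∈ H' → e.symm a ∈ H' := by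
    intro a n hn ha
    simpa using hco _ (-n) (neg_mem hn) ha
  have hmem : ∀ {a}, e.symm a ∈ H' → a ∈ M := fun {a} ha => by
    simpa using (h.mem_top _).1 (hM ha)
  have hcomm : ∀ a b n, n ∈ N → ∃ m ∈ N, a + n + b = a + b + m := fun a b n hn =>
    ⟨-b + n + b, by simpa using h.normal (-b) n hn, by simp [add_assoc]⟩
  refine ⟨{ carrier := {a | e.symm a ∈ H'}, zero_mem' := ?_, add_mem' := ?_, neg_mem' := ?_ },
    fun g => ?_⟩
  · intro a b ha hb
    rcases h.compat with hc | hc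
    · obtain ⟨n, hn, hh⟩ := hc (e.symm a) (e.symm b) (by simpa using hmem ha)
        (by simpa using hmem hb)
      obtain ⟨m, hm, hm'⟩ := hcomm a b n hn
      rw [e.apply_symm_apply, e.apply_symm_apply, hm', ← e.eq_symm_apply] at hh
      exact hco' _ m hm (hh ▸ mul_mem ha hb)
    · obtain ⟨n, hn, hh⟩ := hc (e.symm b) (e.symm a) (by simpa using hmem hb)
        (by simpa using hmem ha)
      obtain ⟨m, hm, hm'⟩ := hcomm a b n hn
      rw [e.apply_symm_apply, e.apply_symm_apply, hm', ← e.eq_symm_apply] at hh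
      exact hco' _ m hm (hh ▸ mul_mem hb ha)
  · have : e.symm 0 = 1 := by rw [← h.map_one, e.symm_apply_apply]
    exact (congrArg (· ∈ H') this).mpr (one_mem H')
  · intro a ha
    have ha' : e (e.symm a)⁻¹ ∈ M := (h.mem_top _).1 (inv_mem (hM ha))
    have haM : e (e.symm a) ∈ M := by simpa using hmem ha
    have key : ∃ n ∈ N, 0 = a + n + e (e.symm a)⁻¹ := by
      rcases h.compat with hc | hc
      · obtain ⟨n, hn, hh⟩ := hc _ _ haM ha'
        rw [mul_inv_cancel, h.map_one, e.apply_symm_apply] at hh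
        exact ⟨n, hn, hh⟩
      · obtain ⟨n, hn, hh⟩ := hc _ _ ha' haM
        rw [inv_mul_cancel, h.map_one, e.apply_symm_apply] at hh
        exact ⟨n, hn, hh⟩
    obtain ⟨n, hn, hh⟩ := key
    obtain ⟨m, hm, hm'⟩ := hcomm a (e (e.symm a)⁻¹) n hn
    rw [hm', add_assoc] at hh
    have h2 : e (e.symm a)⁻¹ + m = -a := eq_neg_of_add_eq_zero_right hh.symm
    have := hco _ m hm (inv_mem ha)
    rwa [h2] at this
  · change _ ↔ e.symm (e g) ∈ H'
    rw [e.symm_apply_apply]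

theorem IsCommonLayer.wellFoundedGT_iff (h : IsCommonLayer e N M N' M') :
    WellFoundedGT (Set.Icc N M) ↔ WellFoundedGT (Set.Icc N' M') := by
  constructor
  · intro hw
    choose f hf using fun H : Set.Icc N' M' => h.exists_addSubgroup H.1 H.2.1 H.2.2
    have hle : ∀ H a, a ∈ f H ↔ e.symm a ∈ H.1 := fun H a => by
      rw [hf, e.apply_symm_apply]
    refine StrictMono.wellFoundedGT (β := Set.Icc N M) (f := fun H => ⟨f H, ?_, ?_⟩) ?_
    · intro a ha
      exact (hle _ _).2 (H.2.1 ((h.mem_bot _).2 (by simpa using ha)))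
    · intro a ha
      simpa using (h.mem_top _).1 (H.2.2 ((hle _ _).1 ha))
    · refine Monotone.strictMono_of_injective (fun H K hHK a ha => ?_) (fun H K hHK => ?_)
      · exact (hle _ _).2 (hHK ((hle _ _).1 ha))
      · ext g
        rw [hf, hf, Subtype.mk.inj hHK]
  · intro hw
    choose f hf using fun H : Set.Icc N M => h.exists_subgroup H.1 H.2.1 H.2.2
    refine StrictMono.wellFoundedGT (β := Set.Icc N' M') (f := fun H => ⟨f H, ?_, ?_⟩) ?_
    · intro a ha
      exact (hf _ _).2 (H.2.1 ((h.mem_bot _).1 ha))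
    · intro a ha
      exact (h.mem_top _).2 (H.2.2 ((hf _ _).1 ha))
    · refine Monotone.strictMono_of_injective (fun H K hHK a ha => ?_) (fun H K hHK => ?_)
      · exact (hf _ _).2 (hHK ((hf _ _).1 ha))
      · ext a
        have := hf H (e.symm a)
        rw [Subtype.mk.inj hHK, hf, e.apply_symm_apply] at this
        exact this.symm

/-- If the operations agree on a layer, the ascending chain conditions below its top are
equivalent as soon as those below its bottom are. -/
theorem IsCommonLayer.wellFoundedGT_Iic_iff (h : IsCommonLayer e N M N' M') (hNM : N ≤ M)
    (hN' : ∀ g, ∀ n ∈ N', g * n * g⁻¹ ∈ N')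
    (hN : WellFoundedGT (Set.Iic N) ↔ WellFoundedGT (Set.Iic N')) :
    WellFoundedGT (Set.Iic M) ↔ WellFoundedGT (Set.Iic M') := by
  have hNM' : N' ≤ M' := fun g hg => (h.mem_top g).2 (hNM ((h.mem_bot g).1 hg))
  rw [AddSubgroup.wellFoundedGT_Iic_iff h.normal hNM, Subgroup.wellFoundedGT_Iic_iff hN' hNM',
    h.wellFoundedGT_iff, hN]

end Layer

instance Int.isJacobsonRing : IsJacobsonRing ℤ := by
  rw [isJacobsonRing_iff_prime_eq]
  intro P hP
  by_cases h : P = ⊥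
  · subst h
    refine le_antisymm (fun x hx => ?_) Ideal.le_jacobson
    by_contra hx0
    have hu := Ideal.mem_jacobson_bot.1 hx (2 * x)
    have hpos : 0 < x * x := mul_self_pos.2 hx0
    rcases Int.isUnit_iff.1 hu with h | h <;> nlinarith
  · have := hP.isMaximal h
    exact Ideal.jacobson_eq_self_of_isMaximal

theorem isNilpotent_of_forall_isUnit {C : Type*} [CommRing C] [Algebra.FiniteType ℤ C] {x : C}
    (hx : ∀ y, IsUnit (x * y + 1)) : IsNilpotent x := by
  have : IsJacobsonRing C := isJacobsonRing_of_finiteType (A := ℤ)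
  have h := Ideal.mem_jacobson_bot.2 hx
  rwa [← Ideal.radical_eq_jacobson] at h

/-- Adjoining a unit to a ring. -/
theorem exists_ring_eq_intCast_add.{u} (R : Type u) [NonUnitalRing R] :
    ∃ (U : Type u) (_ : Ring U) (ι : R →ₙ+* U),
      (∀ x : U, ∃ (z : ℤ) (r : R), x = z + ι r) ∧ Function.Injective ι := by
  refine ⟨Unitization ℤ R, Unitization.instRing,
    { toFun := Unitization.inr
      map_mul' := Unitization.inr_mul ℤ
      map_zero' := Unitization.inr_zero ℤ
      map_add' := Unitization.inr_add ℤ }, fun x => ⟨x.fst, x.snd, ?_⟩,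
    Unitization.inr_injective (R := ℤ)⟩
  have h := eq_intCast (Unitization.inlRingHom ℤ R) x.fst
  exact (Unitization.inl_fst_add_inr_snd_eq x).symm.trans (congrArg (· + _) h)

section RadicalRing

variable {R G : Type*} [NonUnitalRing R] [Group G] {e : G ≃ R}
  {U : Type*} [Ring U] (ι : R →ₙ+* U)

theorem adjoint_map_one
    (he : ∀ g h, e (g * h) = e g + e h + e g * e h) : e 1 = 0 := by
  have h := he 1 (e.symm 0)
  simpa using h.symm

theorem adjoint_mul_inv
    (he : ∀ g h, e (g * h) = e g + e h + e g * e h) (g : G) : e g + e g⁻¹ + e g * e g⁻¹ = 0 := by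
  rw [← he, mul_inv_cancel, adjoint_map_one he]

theorem adjoint_inv_mul
    (he : ∀ g h, e (g * h) = e g + e h + e g * e h) (g : G) : e g⁻¹ + e g + e g⁻¹ * e g = 0 := by
  rw [← he, inv_mul_cancel, adjoint_map_one he]

/-- The embedding of the adjoint group in the units of the unitization. -/
theorem exists_adjoint_unit
    (he : ∀ g h, e (g * h) = e g + e h + e g * e h) (g : G) : ∃ u : Uˣ,
    (u : U) = 1 + ι (e g) ∧
    (↑u⁻¹ : U) = 1 + ι (e g⁻¹) := by
  have key : ∀ a b : R, a + b + a * b = 0 →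
      (1 + ι a) * (1 + ι b) = 1 := by
    intro a b hab
    have : (1 + ι a) * (1 + ι b) =
        1 + ι (a + b + a * b) := by
      rw [map_add, map_add, map_mul]
      noncomm_ring
    rw [this, hab, map_zero, add_zero]
  exact ⟨⟨_, _, key _ _ (adjoint_mul_inv he g), key _ _ (adjoint_inv_mul he g)⟩, rfl, rfl⟩

theorem adjoint_inv_mem_centralizer
    (he : ∀ g h, e (g * h) = e g + e h + e g * e h) {s : Set U} {g : G}
    (hg : ι (e g) ∈ Subalgebra.centralizer ℤ s) :
    ι (e g⁻¹) ∈ Subalgebra.centralizer ℤ s := by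
  obtain ⟨u, hu, hu'⟩ := exists_adjoint_unit ι he g
  rw [Subalgebra.mem_centralizer_iff] at hg ⊢
  intro z hz
  have h1 : Commute z (u : U) := by
    rw [hu]
    exact (Commute.one_right z).add_right (hg z hz)
  have h2 := h1.units_inv_right
  rw [hu'] at h2
  have h3 := h2.sub_right (Commute.one_right z)
  rwa [add_sub_cancel_left] at h3

theorem Subalgebra.eq_of_forall_mem (hι : ∀ x, ∃ (z : ℤ) (r : R), x = z + ι r)
    {C D : Subalgebra ℤ U} (hDC : D ≤ C)
    (h : ∀ r : R, ι r ∈ C → ι r ∈ D) : D = C := by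
  refine le_antisymm hDC fun x hx => ?_
  obtain ⟨z, r, rfl⟩ := hι x
  exact add_mem (intCast_mem D z) (h _ ((add_mem_cancel_left (intCast_mem C z)).1 hx))

theorem subalgebra_fg_of_wellFoundedGT
    (he : ∀ g h, e (g * h) = e g + e h + e g * e h)
    (hι : ∀ x, ∃ (z : ℤ) (r : R), x = z + ι r)
    (hW : WellFoundedGT (AddSubgroup R) ∨ WellFoundedGT (Subgroup G))
    (C : Subalgebra ℤ U)
    (hC : ∀ g, ι (e g) ∈ C → ι (e g⁻¹) ∈ C) : C.FG := by
  rcases hW with hW | hW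
  · obtain ⟨S, hS, hSC⟩ := AddSubgroup.exists_finite_closure_eq
      ((C.toSubring.toAddSubgroup).comap (ι : R →+ U))
    have hmem : ∀ r, r ∈ AddSubgroup.closure S ↔ ι r ∈ C := fun r => by
      rw [hSC]; rfl
    refine Subalgebra.fg_def.2 ⟨ι '' S, hS.image _, ?_⟩
    refine Subalgebra.eq_of_forall_mem ι hι (Algebra.adjoin_le ?_) fun r hr => ?_
    · rintro _ ⟨s, hs, rfl⟩
      exact (hmem s).1 (AddSubgroup.subset_closure hs)
    · rw [← hmem] at hr
      induction hr using AddSubgroup.closure_induction with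
      | mem x hx => exact Algebra.subset_adjoin ⟨x, hx, rfl⟩
      | zero => rw [map_zero]; exact zero_mem _
      | add x y _ _ hx hy => rw [map_add]; exact add_mem hx hy
      | neg x _ hx => rw [map_neg]; exact neg_mem hx
  · let H : Subgroup G :=
      { carrier := {g | ι (e g) ∈ C}
        one_mem' := by
          change ι (e 1) ∈ C
          rw [adjoint_map_one he, map_zero]; exact zero_mem _
        mul_mem' := by
          intro a b ha hb
          change ι (e (a * b)) ∈ C
          rw [he, map_add, map_add, map_mul]
          exact add_mem (add_mem ha hb) (mul_mem ha hb)
        inv_mem' := fun {g} hg => hC g hg }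
    obtain ⟨S, hS, hSC⟩ := Subgroup.exists_finite_closure_eq H
    refine Subalgebra.fg_def.2 ⟨(fun g : G => ι (e g)) '' (S ∪ S⁻¹),
      (hS.union hS.inv).image _, ?_⟩
    have hle : Submonoid.closure (S ∪ S⁻¹) = H.toSubmonoid := by
      rw [← hSC, Subgroup.closure_toSubmonoid]
    refine Subalgebra.eq_of_forall_mem ι hι (Algebra.adjoin_le ?_) fun r hr => ?_
    · rintro _ ⟨s, hs, rfl⟩
      have : s ∈ H.toSubmonoid := hle ▸ Submonoid.subset_closure hs
      exact this
    · have hr' : e.symm r ∈ Submonoid.closure (S ∪ S⁻¹) := by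
        rw [hle]
        change ι (e (e.symm r)) ∈ C
        rwa [e.apply_symm_apply]
      rw [← e.apply_symm_apply r]
      generalize e.symm r = g at hr'
      induction hr' using Submonoid.closure_induction with
      | mem x hx => exact Algebra.subset_adjoin ⟨x, hx, rfl⟩
      | one => rw [adjoint_map_one he, map_zero]; exact zero_mem _
      | mul x y _ _ hx hy =>
        rw [he, map_add, map_add, map_mul]
        exact add_mem (add_mem hx hy) (mul_mem hx hy)

/-- A radical ring whose additive or adjoint group satisfies the maximum condition is nil. -/
theorem isNilpotent_inr_of_wellFoundedGT
    (he : ∀ g h, e (g * h) = e g + e h + e g * e h)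
    (hι : ∀ x, ∃ (z : ℤ) (r : R), x = z + ι r)
    (hW : WellFoundedGT (AddSubgroup R) ∨ WellFoundedGT (Subgroup G)) (a : R) :
    IsNilpotent (ι a) := by
  set Z := Subalgebra.centralizer ℤ {ι a}
  set C := Subalgebra.centralizer ℤ (Z : Set U) with hCdef
  have haC : ι a ∈ C := by
    rw [hCdef, Subalgebra.mem_centralizer_iff]
    intro z hz
    exact ((Subalgebra.mem_centralizer_iff ℤ).1 hz _ rfl).symm
  have hCZ : C ≤ Z := by
    intro x hx
    refine (Subalgebra.mem_centralizer_iff ℤ).2 ?_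
    rintro _ rfl
    refine (Subalgebra.mem_centralizer_iff ℤ).1 hx _ ?_
    exact (Subalgebra.mem_centralizer_iff ℤ).2 fun _ h => by rw [Set.mem_singleton_iff.1 h]
  let _ : CommRing C :=
    { (inferInstance : Ring C) with
      mul_comm := fun x y => Subtype.ext ((Subalgebra.mem_centralizer_iff ℤ).1 y.2 x (hCZ x.2)) }
  have hinv : ∀ g, ι (e g) ∈ C → ι (e g⁻¹) ∈ C :=
    fun g => adjoint_inv_mem_centralizer ι he
  have hfg := subalgebra_fg_of_wellFoundedGT ι he hι hW C hinv
  have : Algebra.FiniteType ℤ C := C.fg_iff_finiteType.1 hfg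
  have hnil : IsNilpotent (⟨ι a, haC⟩ : C) := by
    refine isNilpotent_of_forall_isUnit fun y => ?_
    obtain ⟨r, hr⟩ : ∃ r : R, ι a * y = ι r := by
      obtain ⟨z, s, hy⟩ := hι y
      refine ⟨z • a + a * s, ?_⟩
      rw [hy, mul_add, map_add, map_mul, map_zsmul, zsmul_eq_mul, Int.cast_comm]
    have hrC : ι r ∈ C := hr ▸ mul_mem haC y.2
    obtain ⟨u, hu, hu'⟩ := exists_adjoint_unit ι he (e.symm r)
    have hv : (↑u⁻¹ : U) ∈ C := by
      rw [hu']
      exact add_mem (one_mem C) (hinv _ (by rwa [e.apply_symm_apply]))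
    refine IsUnit.of_mul_eq_one (⟨_, hv⟩ : C) (Subtype.ext ?_)
    change (ι a * y + 1) * ↑u⁻¹ = 1
    rw [hr, add_comm, ← e.apply_symm_apply r, ← hu, Units.mul_inv]
  obtain ⟨n, hn⟩ := hnil
  exact ⟨n, congrArg (Subtype.val : C → U) hn⟩

theorem iterate_mul_eq_pow (u : R) (k : ℕ) : ι ((· * u)^[k] u) = ι u ^ (k + 1) := by
  induction k with
  | zero => simp
  | succ k ih => rw [Function.iterate_succ_apply', map_mul, ih, pow_succ _ (k + 1)]

theorem exists_iterate_mul_eq_zero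
    (he : ∀ g h, e (g * h) = e g + e h + e g * e h)
    (hW : WellFoundedGT (AddSubgroup R) ∨ WellFoundedGT (Subgroup G)) (u : R) :
    ∃ k, (· * u)^[k] u = 0 := by
  obtain ⟨U, _, ι, hι, hinj⟩ := exists_ring_eq_intCast_add R
  obtain ⟨k, hk⟩ := isNilpotent_inr_of_wellFoundedGT ι he hι hW u
  refine ⟨k, hinj ?_⟩
  rw [iterate_mul_eq_pow, pow_succ, hk, zero_mul, map_zero]

/-- A right ideal of a radical ring, as a subgroup of the adjoint group. -/
def adjointSubgroup
    (he : ∀ g h, e (g * h) = e g + e h + e g * e h) (H : AddSubgroup R) (hH : ∀ x ∈ H, ∀ r, x * r ∈ H) : Subgroup G where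
  carrier := {g | e g ∈ H}
  one_mem' := (congrArg (· ∈ H) (adjoint_map_one he)).mpr H.zero_mem
  mul_mem' := fun {a b} ha hb =>
    (congrArg (· ∈ H) (he a b)).mpr (add_mem (add_mem ha hb) (hH _ ha _))
  inv_mem' := fun {g} hg => by
    have h : e g⁻¹ = -(e g + e g * e g⁻¹) :=
      eq_neg_of_add_eq_zero_right (by rw [← adjoint_mul_inv he g]; abel)
    exact (congrArg (· ∈ H) h).mpr (neg_mem (add_mem hg (hH _ hg _)))

theorem wellFoundedGT_rightIdeal
    (he : ∀ g h, e (g * h) = e g + e h + e g * e h)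
    (hW : WellFoundedGT (AddSubgroup R) ∨ WellFoundedGT (Subgroup G)) :
    WellFoundedGT {H : AddSubgroup R // ∀ x ∈ H, ∀ r, x * r ∈ H} := by
  rcases hW with hW | hW
  · infer_instance
  · refine StrictMono.wellFoundedGT (β := Subgroup G)
      (f := fun H => adjointSubgroup he H.1 H.2) ?_
    refine Monotone.strictMono_of_injective (fun H K hHK g hg => hHK hg) fun H K hHK => ?_
    ext x
    have : e.symm x ∈ adjointSubgroup he H.1 H.2 ↔ e.symm x ∈ adjointSubgroup he K.1 K.2 := by
      rw [hHK]
    change e (e.symm x) ∈ H.1 ↔ e (e.symm x) ∈ K.1 at this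
    rwa [e.apply_symm_apply] at this

/-- Levitzki's argument: in a nil ring with the maximum condition on right ideals, modulo a proper
ideal there is a nonzero element generating an ideal of square zero. -/
theorem exists_mul_self_mem_of_nil
    (hR : WellFoundedGT {H : AddSubgroup R // ∀ x ∈ H, ∀ r, x * r ∈ H})
    (hnil : ∀ u : R, ∃ k, (· * u)^[k] u = 0) (N : AddSubgroup R)
    (hl : ∀ x ∈ N, ∀ r, r * x ∈ N) (hr : ∀ x ∈ N, ∀ r, x * r ∈ N) (hN : N ≠ ⊤) :
    ∃ a ∉ N, a * a ∈ N ∧ ∀ r, a * r * a ∈ N := by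
  let ann : R → {H : AddSubgroup R // ∀ x ∈ H, ∀ r, x * r ∈ H} := fun a =>
    ⟨N.comap (AddMonoidHom.mulLeft a), fun x hx r => by
      change a * (x * r) ∈ N
      rw [← mul_assoc]
      exact hr _ hx r⟩
  have hann : ∀ a x, x ∈ (ann a).1 ↔ a * x ∈ N := fun a x => Iff.rfl
  obtain ⟨b, hb⟩ : ∃ b, b ∉ N := by
    by_contra! h
    exact hN ((AddSubgroup.eq_top_iff' N).2 h)
  obtain ⟨_, ⟨a, ha, rfl⟩, hmax⟩ := hR.wf.has_min (ann '' {a | a ∉ N}) ⟨_, b, hb, rfl⟩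
  have hmax' : ∀ y, y * a ∉ N → ∀ x, y * a * x ∈ N → a * x ∈ N := by
    intro y hy x hx
    have hle : ann a ≤ ann (y * a) := fun z hz => by
      change y * a * z ∈ N
      rw [mul_assoc]
      exact hl _ hz y
    have hge : ann (y * a) ≤ ann a := by
      by_contra hcon
      exact hmax _ ⟨_, hy, rfl⟩ (lt_of_le_not_ge hle hcon)
    exact hge hx
  have haRa : ∀ x, a * x * a ∈ N := by
    intro x
    rw [mul_assoc]
    by_cases hxa : x * a ∈ N
    · exact hl _ hxa a
    have hex : ∃ k, (· * (x * a))^[k] (x * a) ∈ N := by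
      obtain ⟨k, hk⟩ := hnil (x * a)
      exact ⟨k, hk ▸ N.zero_mem⟩
    classical
    obtain ⟨k, hk⟩ : ∃ k, Nat.find hex = k + 1 := Nat.exists_eq_succ_of_ne_zero fun h0 => by
      have := Nat.find_spec hex
      rw [h0] at this
      exact hxa this
    have h1 := Nat.find_spec hex
    rw [hk, Function.iterate_succ_apply'] at h1
    have h2 := Nat.find_min hex (m := k) (by omega)
    obtain ⟨y, hy⟩ : ∃ y, (· * (x * a))^[k] (x * a) = y * a := by
      cases k with
      | zero => exact ⟨x, rfl⟩
      | succ k => exact ⟨_, by rw [Function.iterate_succ_apply', ← mul_assoc]⟩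
    rw [hy] at h1 h2
    exact hmax' y h2 _ h1
  by_cases haa : a * a ∈ N
  · exact ⟨a, ha, haa, haRa⟩
  · refine ⟨a * a, haa, ?_, fun r => ?_⟩
    · rw [← mul_assoc]
      exact hr _ (haRa a) a
    · have : a * a * r * (a * a) = a * (a * r) * a * a := by simp only [mul_assoc]
      rw [this]
      exact hr _ (haRa _) a

theorem exists_ideal_gt_of_mul_self_mem (N : AddSubgroup R)
    (hl : ∀ x ∈ N, ∀ r, r * x ∈ N) (hr : ∀ x ∈ N, ∀ r, x * r ∈ N)
    {a : R} (ha : a ∉ N) (haa : a * a ∈ N) (haRa : ∀ r, a * r * a ∈ N) :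
    ∃ M : AddSubgroup R, N < M ∧ (∀ x ∈ M, ∀ r, r * x ∈ M) ∧ (∀ x ∈ M, ∀ r, x * r ∈ M) ∧
      ∀ x ∈ M, ∀ y ∈ M, x * y ∈ N := by
  let L : AddSubgroup R :=
    { carrier := {x | x * a ∈ N ∧ ∀ r, x * r * a ∈ N}
      zero_mem' := by simp [N.zero_mem]
      add_mem' := fun {x y} hx hy => by
        refine ⟨?_, fun r => ?_⟩
        · rw [add_mul]; exact add_mem hx.1 hy.1
        · rw [add_mul, add_mul]; exact add_mem (hx.2 r) (hy.2 r)
      neg_mem' := fun {x} hx => by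
        refine ⟨?_, fun r => ?_⟩
        · rw [neg_mul]; exact neg_mem hx.1
        · rw [neg_mul, neg_mul]; exact neg_mem (hx.2 r) }
  have hLl : ∀ x ∈ L, ∀ r, r * x ∈ L := fun x hx r => by
    refine ⟨?_, fun s => ?_⟩
    · rw [mul_assoc]; exact hl _ hx.1 r
    · rw [mul_assoc r, mul_assoc r]; exact hl _ (hx.2 s) r
  have hLr : ∀ x ∈ L, ∀ r, x * r ∈ L := fun x hx r =>
    ⟨hx.2 r, fun s => by rw [mul_assoc x]; exact hx.2 _⟩
  have hNL : N ≤ L := fun x hx => ⟨hr _ hx _, fun r => hr _ (hr _ hx _) _⟩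
  let M : AddSubgroup R :=
    { carrier := {y | y ∈ L ∧ ∀ x ∈ L, x * y ∈ N}
      zero_mem' := ⟨L.zero_mem, fun x _ => by rw [mul_zero]; exact N.zero_mem⟩
      add_mem' := fun {y z} hy hz =>
        ⟨add_mem hy.1 hz.1, fun x hx => by rw [mul_add]; exact add_mem (hy.2 x hx) (hz.2 x hx)⟩
      neg_mem' := fun {y} hy =>
        ⟨neg_mem hy.1, fun x hx => by rw [mul_neg]; exact neg_mem (hy.2 x hx)⟩ }
  have haM : a ∈ M := ⟨⟨haa, haRa⟩, fun x hx => hx.1⟩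
  refine ⟨M, lt_of_le_of_ne (fun x hx => ⟨hNL hx, fun y _ => hl _ hx y⟩) fun h => ha (h ▸ haM),
    fun y hy r => ⟨hLl _ hy.1 r, fun x hx => ?_⟩, fun y hy r => ⟨hLr _ hy.1 r, fun x hx => ?_⟩,
    fun x hx y hy => hy.2 x hx.1⟩
  · rw [← mul_assoc]; exact hy.2 _ (hLr x hx r)
  · rw [← mul_assoc]; exact hr _ (hy.2 x hx) r

theorem adjoint_conj_mem
    (he : ∀ g h, e (g * h) = e g + e h + e g * e h) (N : AddSubgroup R)
    (hl : ∀ x ∈ N, ∀ r, r * x ∈ N) (hr : ∀ x ∈ N, ∀ r, x * r ∈ N) (g n : G) (hn : e n ∈ N) :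
    e (g * n * g⁻¹) ∈ N := by
  have h : e (g * n * g⁻¹) = (e g + e g⁻¹ + e g * e g⁻¹) +
      ((e n + e g * e n) + (e n + e g * e n) * e g⁻¹) := by
    rw [he, he]
    noncomm_ring
  rw [h, adjoint_mul_inv he, zero_add]
  have hm := add_mem hn (hl _ hn (e g))
  exact add_mem hm (hr _ hm _)

theorem isCommonLayer_of_mul_mem
    (he : ∀ g h, e (g * h) = e g + e h + e g * e h) {N M : AddSubgroup R}
    (hl : ∀ x ∈ N, ∀ r, r * x ∈ N) (hr : ∀ x ∈ N, ∀ r, x * r ∈ N)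
    (hMr : ∀ x ∈ M, ∀ r, x * r ∈ M) (hMM : ∀ x ∈ M, ∀ y ∈ M, x * y ∈ N) :
    IsCommonLayer e N M (adjointSubgroup he N hr) (adjointSubgroup he M hMr) where
  mem_bot _ := Iff.rfl
  mem_top _ := Iff.rfl
  normal a n hn := by rwa [add_neg_cancel_comm]
  coset g n hn := by
    refine ⟨e.symm (n + e g⁻¹ * n), ?_, ?_⟩
    · change e (e.symm _) ∈ N
      rw [e.apply_symm_apply]
      exact add_mem hn (hl _ hn _)
    · rw [he, e.apply_symm_apply]
      have : e g + (n + e g⁻¹ * n) + e g * (n + e g⁻¹ * n) =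
          e g + n + (e g + e g⁻¹ + e g * e g⁻¹) * n := by noncomm_ring
      rw [this, adjoint_mul_inv he, zero_mul, add_zero]
  map_one := adjoint_map_one he
  compat := Or.inl fun g h hg hh => ⟨e g * e h, hMM _ hg _ hh, by rw [he]; abel⟩

/-- Watters' theorem: the additive group of a radical ring satisfies the maximum condition on
subgroups if and only if its adjoint group does. -/
theorem wellFoundedGT_addSubgroup_iff_adjoint
    (he : ∀ g h, e (g * h) = e g + e h + e g * e h) :
    WellFoundedGT (AddSubgroup R) ↔ WellFoundedGT (Subgroup G) := by
  suffices h : (WellFoundedGT (AddSubgroup R) ∨ WellFoundedGT (Subgroup G)) →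
      (WellFoundedGT (AddSubgroup R) ↔ WellFoundedGT (Subgroup G)) from
    ⟨fun h1 => (h (Or.inl h1)).1 h1, fun h1 => (h (Or.inr h1)).2 h1⟩
  intro hW
  have hR := wellFoundedGT_rightIdeal he hW
  let good : Set {H : AddSubgroup R // ∀ x ∈ H, ∀ r, x * r ∈ H} := {N |
    (∀ x ∈ N.1, ∀ r, r * x ∈ N.1) ∧
    (WellFoundedGT (Set.Iic N.1) ↔ WellFoundedGT (Set.Iic (adjointSubgroup he N.1 N.2)))}
  have hbot : ∀ x ∈ (⊥ : AddSubgroup R), ∀ r, x * r ∈ (⊥ : AddSubgroup R) := by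
    intro x hx r
    rw [AddSubgroup.mem_bot.1 hx, zero_mul]
    exact zero_mem _
  have hbot' : adjointSubgroup he ⊥ hbot = ⊥ := by
    ext g
    change e g = 0 ↔ g = 1
    rw [← adjoint_map_one he, e.apply_eq_iff_eq]
  have hne : good.Nonempty := by
    refine ⟨⟨⊥, hbot⟩, fun x hx r => ?_, ?_⟩
    · rw [AddSubgroup.mem_bot.1 hx, mul_zero]
      exact zero_mem _
    · have h1 : Finite (Set.Iic (⊥ : AddSubgroup R)) := by
        rw [Set.Iic_bot]; infer_instance
      have h2 : Finite (Set.Iic (⊥ : Subgroup G)) := by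
        rw [Set.Iic_bot]; infer_instance
      rw [hbot']
      exact iff_of_true inferInstance inferInstance
  obtain ⟨⟨N, hr⟩, ⟨hl, hN⟩, hmax⟩ := hR.wf.has_min good hne
  by_cases htop : N = ⊤
  · subst htop
    have : adjointSubgroup he ⊤ hr = ⊤ := by
      ext g
      exact iff_of_true (AddSubgroup.mem_top (e g)) (Subgroup.mem_top g)
    rw [this] at hN
    rwa [AddSubgroup.wellFoundedGT_Iic_top_iff, Subgroup.wellFoundedGT_Iic_top_iff] at hN
  · obtain ⟨a, ha, haa, haRa⟩ := exists_mul_self_mem_of_nil hR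
      (exists_iterate_mul_eq_zero he hW) N hl hr htop
    obtain ⟨M, hNM, hMl, hMr, hMM⟩ := exists_ideal_gt_of_mul_self_mem N hl hr ha haa haRa
    exfalso
    refine hmax ⟨M, hMr⟩ ⟨hMl, ?_⟩ hNM
    exact (isCommonLayer_of_mul_mem he hl hr hMr hMM).wellFoundedGT_Iic_iff hNM.le
      (adjoint_conj_mem he N hl hr) hN

end RadicalRing

/-- The radical ring structure determined by a circle operation on an abelian group. -/
abbrev nonUnitalRingOfCircle {B : Type*} [AddCommGroup B] (m : B → B → B)
    (hassoc : ∀ a b c, m (m a b) c = m a (m b c))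
    (hleft : ∀ a b c, m a (b + c) = m a b - a + m a c)
    (hright : ∀ a b c, m (a + b) c = m a c - c + m b c) : NonUnitalRing B :=
  have hl0 : ∀ a, m a 0 = a := fun a => by
    have h := hleft a 0 0
    rw [add_zero, sub_add_eq_add_sub, eq_sub_iff_add_eq] at h
    exact (add_left_cancel h).symm
  have hr0 : ∀ a, m 0 a = a := fun a => by
    have h := hright 0 0 a
    rw [add_zero, sub_add_eq_add_sub, eq_sub_iff_add_eq] at h
    exact (add_left_cancel h).symm
  have hlsub : ∀ a b c, m a (b - c) = m a b + a - m a c := fun a b c => by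
    have h := hleft a (b - c) c
    rw [sub_add_cancel] at h
    rw [h]; abel
  have hrsub : ∀ a b c, m (a - b) c = m a c + c - m b c := fun a b c => by
    have h := hright (a - b) b c
    rw [sub_add_cancel] at h
    rw [h]; abel
  { (inferInstance : AddCommGroup B) with
    mul := fun a b => m a b - a - b
    left_distrib := fun a b c => by
      change m a (b + c) - a - (b + c) = (m a b - a - b) + (m a c - a - c)
      rw [hleft]; abel
    right_distrib := fun a b c => by
      change m (a + b) c - (a + b) - c = (m a c - a - c) + (m b c - b - c)
      rw [hright]; abel
    zero_mul := fun a => by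
      change m 0 a - 0 - a = 0
      rw [hr0]; abel
    mul_zero := fun a => by
      change m a 0 - a - 0 = 0
      rw [hl0]; abel
    mul_assoc := fun a b c => by
      change m (m a b - a - b) c - (m a b - a - b) - c =
        m a (m b c - b - c) - a - (m b c - b - c)
      rw [hrsub, hrsub, hlsub, hlsub, hassoc]; abel }

namespace TwoSidedSkewBrace

variable {A : Type*} [AddGroup A]

theorem add_conj_mem_closure {S : Set A}
    (hS : ∀ a, ∀ s ∈ S, a + s + -a ∈ AddSubgroup.closure S) (a n : A)
    (hn : n ∈ AddSubgroup.closure S) : a + n + -a ∈ AddSubgroup.closure S := by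
  have h : AddSubgroup.closure S ≤
      (AddSubgroup.closure S).comap (AddAut.addConj a).toAddMonoidHom := by
    rw [AddSubgroup.closure_le]
    exact fun s hs => hS a s hs
  exact h hn

variable [Group A]

/-- Ideals of a skew brace. -/
structure IsBraceIdeal (N : AddSubgroup A) : Prop where
  add_conj : ∀ a, ∀ n ∈ N, a + n + -a ∈ N
  mul_conj : ∀ a, ∀ n ∈ N, a * n * a⁻¹ ∈ N
  lam : ∀ a, ∀ n ∈ N, -a + a * n ∈ N

theorem IsBraceIdeal.inf {M N : AddSubgroup A} (hM : IsBraceIdeal M) (hN : IsBraceIdeal N) :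
    IsBraceIdeal (M ⊓ N) where
  add_conj a n hn := ⟨hM.add_conj a n hn.1, hN.add_conj a n hn.2⟩
  mul_conj a n hn := ⟨hM.mul_conj a n hn.1, hN.mul_conj a n hn.2⟩
  lam a n hn := ⟨hM.lam a n hn.1, hN.lam a n hn.2⟩

theorem IsBraceIdeal.top : IsBraceIdeal (⊤ : AddSubgroup A) where
  add_conj _ _ _ := AddSubgroup.mem_top _
  mul_conj _ _ _ := AddSubgroup.mem_top _
  lam _ _ _ := AddSubgroup.mem_top _

variable (A) in
/-- The additive subgroup generated by the elements `-a + a ∘ b - b`. -/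
def starIdeal : AddSubgroup A := AddSubgroup.closure {x | ∃ a b : A, x = -a + a * b - b}

variable (A) in
/-- The additive subgroup generated by the elements `-b + a ∘ b - a`. -/
def opStarIdeal : AddSubgroup A := AddSubgroup.closure {x | ∃ a b : A, x = -b + a * b - a}

theorem star_mem (a b : A) : -a + a * b - b ∈ starIdeal A :=
  AddSubgroup.subset_closure ⟨a, b, rfl⟩

theorem opStar_mem (a b : A) : -b + a * b - a ∈ opStarIdeal A :=
  AddSubgroup.subset_closure ⟨a, b, rfl⟩

variable [IsTwoSidedSkewBrace A]

theorem mul_add' (a b c : A) : a * (b + c) = a * b - a + a * c := IsSkewBrace.mul_add_eq a b c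

theorem add_mul' (a b c : A) : (a + b) * c = a * c - c + b * c :=
  IsTwoSidedSkewBrace.add_mul_eq a b c

theorem one_eq_zero : (1 : A) = 0 := by
  have h := mul_add' (1 : A) 0 0
  simp only [one_mul, add_zero, zero_sub] at h
  exact (neg_eq_zero.1 h.symm)

/-- Conjugation in the multiplicative group is an endomorphism of the additive group. -/
theorem conj_add (c x y : A) : c * (x + y) * c⁻¹ = c * x * c⁻¹ + c * y * c⁻¹ := by
  have h1 : c * (x + y) = c * x + (-c + c * y) := by rw [mul_add', sub_eq_add_neg, add_assoc]
  have h2 : (-c + c * y) * c⁻¹ = c⁻¹ + c * y * c⁻¹ := by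
    have h := add_mul' c (-c + c * y) c⁻¹
    rw [add_neg_cancel_left, mul_inv_cancel, one_eq_zero, zero_sub] at h
    rw [h, add_neg_cancel_left]
  rw [h1, add_mul', h2, sub_eq_add_neg, add_assoc, neg_add_cancel_left]

/-- Conjugation by `c` in the multiplicative group, as an endomorphism of the additive group. -/
def conjHom (c : A) : A →+ A := AddMonoidHom.mk' (fun x => c * x * c⁻¹) (conj_add c)

theorem conjHom_mul (c x y : A) : conjHom c (x * y) = conjHom c x * conjHom c y := by
  change c * (x * y) * c⁻¹ = c * x * c⁻¹ * (c * y * c⁻¹)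
  group

/-- An ideal as a subgroup of the multiplicative group. -/
def IsBraceIdeal.toSubgroup {N : AddSubgroup A} (hN : IsBraceIdeal N) : Subgroup A where
  carrier := N
  one_mem' := (one_eq_zero (A := A)) ▸ N.zero_mem
  mul_mem' := fun {a b} ha hb => by
    have h := add_mem ha (hN.lam a b hb)
    rwa [add_neg_cancel_left] at h
  inv_mem' := fun {a} ha => by
    have h := hN.lam a⁻¹ a ha
    rw [inv_mul_cancel, one_eq_zero, add_zero] at h
    exact neg_mem_iff.1 h

theorem IsBraceIdeal.mul_mem {N : AddSubgroup A} (hN : IsBraceIdeal N) {a b : A} (ha : a ∈ N)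
    (hb : b ∈ N) : a * b ∈ N :=
  hN.toSubgroup.mul_mem ha hb

theorem IsBraceIdeal.exists_mul_eq_add {N : AddSubgroup A} (hN : IsBraceIdeal N) (g n : A)
    (hn : n ∈ N) : ∃ n' ∈ N, g * n' = g + n := by
  refine ⟨g⁻¹ * (g + n), ?_, mul_inv_cancel_left _ _⟩
  have h := hN.lam g⁻¹ n hn
  rwa [mul_add', inv_mul_cancel, one_eq_zero, zero_sub]

theorem IsBraceIdeal.isCommonLayer {N M : AddSubgroup A} (hN : IsBraceIdeal N)
    (hM : IsBraceIdeal M) (h : (∀ a ∈ M, ∀ b ∈ M, -a + a * b - b ∈ N) ∨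
      (∀ a ∈ M, ∀ b ∈ M, -b + a * b - a ∈ N)) :
    IsCommonLayer (Equiv.refl A) N M hN.toSubgroup hM.toSubgroup where
  mem_bot _ := Iff.rfl
  mem_top _ := Iff.rfl
  normal := hN.add_conj
  coset := hN.exists_mul_eq_add
  map_one := one_eq_zero
  compat := h.imp
    (fun h a b ha hb => ⟨_, h a ha b hb, by simp [sub_eq_add_neg, add_assoc]⟩)
    (fun h a b ha hb => ⟨_, h a ha b hb, by simp [sub_eq_add_neg, add_assoc]⟩)

theorem mul_conj_mem_closure {S : Set A} (hS : ∀ c, ∀ s ∈ S, conjHom c s ∈ S) (c n : A)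
    (hn : n ∈ AddSubgroup.closure S) : c * n * c⁻¹ ∈ AddSubgroup.closure S := by
  have h : AddSubgroup.closure S ≤ (AddSubgroup.closure S).comap (conjHom c) := by
    rw [AddSubgroup.closure_le]
    exact fun s hs => AddSubgroup.subset_closure (hS c s hs)
  exact h hn

theorem isBraceIdeal_starIdeal : IsBraceIdeal (starIdeal A) := by
  have hadd : ∀ a, ∀ n ∈ starIdeal A, a + n + -a ∈ starIdeal A := by
    refine add_conj_mem_closure ?_
    rintro b _ ⟨a, c, rfl⟩
    have h : b + (-a + a * c - c) + -b = -(-a + a * b - b) + (-a + a * (b + c) - (b + c)) := by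
      rw [mul_add']
      simp [sub_eq_add_neg, add_assoc]
    rw [h]
    exact add_mem (neg_mem (star_mem a b)) (star_mem a (b + c))
  have hmul : ∀ c, ∀ n ∈ starIdeal A, c * n * c⁻¹ ∈ starIdeal A := by
    refine mul_conj_mem_closure ?_
    rintro c _ ⟨a, b, rfl⟩
    exact ⟨conjHom c a, conjHom c b, by rw [map_sub, map_add, map_neg, conjHom_mul]⟩
  refine ⟨hadd, hmul, fun c x hx => ?_⟩
  have hx' := hmul c x hx
  have h : -c + c * x = -c + (c * x * c⁻¹ + (-(c * x * c⁻¹) + c * x * c⁻¹ * c - c)) + -(-c) := by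
    simp [sub_eq_add_neg, add_assoc]
  rw [h]
  exact hadd _ _ (add_mem hx' (star_mem _ _))

theorem isBraceIdeal_opStarIdeal : IsBraceIdeal (opStarIdeal A) := by
  have hadd : ∀ a, ∀ n ∈ opStarIdeal A, a + n + -a ∈ opStarIdeal A := by
    refine add_conj_mem_closure ?_
    rintro b _ ⟨d, c, rfl⟩
    have h : b + (-c + d * c - d) + -b = -(-c + b * c - b) + (-c + (b + d) * c - (b + d)) := by
      rw [add_mul']
      simp [sub_eq_add_neg, add_assoc]
    rw [h]
    exact add_mem (neg_mem (opStar_mem b c)) (opStar_mem (b + d) c)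
  have hmul : ∀ c, ∀ n ∈ opStarIdeal A, c * n * c⁻¹ ∈ opStarIdeal A := by
    refine mul_conj_mem_closure ?_
    rintro c _ ⟨a, b, rfl⟩
    exact ⟨conjHom c a, conjHom c b, by rw [map_sub, map_add, map_neg, conjHom_mul]⟩
  refine ⟨hadd, hmul, fun c x hx => ?_⟩
  have h : -c + c * x = (-c + c * x * c⁻¹ * c - c * x * c⁻¹) + c * x * c⁻¹ := by simp
  rw [h]
  exact add_mem (opStar_mem _ _) (hmul c x hx)

theorem star_add_opStar_comm (a b c d : A) :
    (-a + a * d - d) + (-c + b * c - b) = (-c + b * c - b) + (-a + a * d - d) := by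
  have h1 : (a + b) * (c + d) = a * c - c + b * c - b - a + a * d - d + b * d := by
    rw [mul_add', add_mul', add_mul']
    simp [sub_eq_add_neg, add_assoc]
  have h2 : (a + b) * (c + d) = a * c - a + a * d - d - c + b * c - b + b * d := by
    rw [add_mul', mul_add', mul_add']
    simp [sub_eq_add_neg, add_assoc]
  have h := h2.symm.trans h1
  simp only [sub_eq_add_neg, add_assoc] at h
  have h3 := add_left_cancel h
  simp only [← add_assoc] at h3
  have h4 := add_right_cancel h3
  simpa only [sub_eq_add_neg, ← add_assoc] using h4

theorem add_comm_of_mem {x y : A} (hx : x ∈ starIdeal A) (hy : y ∈ opStarIdeal A) :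
    x + y = y + x := by
  induction hx using AddSubgroup.closure_induction with
  | mem x hx =>
    obtain ⟨a, d, rfl⟩ := hx
    induction hy using AddSubgroup.closure_induction with
    | mem y hy =>
      obtain ⟨b, c, rfl⟩ := hy
      exact star_add_opStar_comm a b c d
    | zero => rw [add_zero, zero_add]
    | add y z _ _ hy hz => exact AddCommute.add_right hy hz
    | neg y _ hy => exact AddCommute.neg_right hy
  | zero => rw [add_zero, zero_add]
  | add x z _ _ hx hz => exact AddCommute.add_left hx hz
  | neg x _ hx => exact AddCommute.neg_left hx

/-- An additively commutative ideal is a radical ring. -/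
theorem IsBraceIdeal.wellFoundedGT_Iic_iff_of_comm {K : AddSubgroup A} (hK : IsBraceIdeal K)
    (hcomm : ∀ x ∈ K, ∀ y ∈ K, x + y = y + x) :
    WellFoundedGT (Set.Iic K) ↔ WellFoundedGT (Set.Iic hK.toSubgroup) := by
  let _ : AddCommGroup K :=
    { (inferInstance : AddGroup K) with
      add_comm := fun x y => Subtype.ext (hcomm x x.2 y y.2) }
  let m : K → K → K := fun a b => ⟨a * b, hK.mul_mem a.2 b.2⟩
  let _ : NonUnitalRing K := nonUnitalRingOfCircle m
    (fun a b c => Subtype.ext (mul_assoc _ _ _)) (fun a b c => Subtype.ext (mul_add' _ _ _))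
    (fun a b c => Subtype.ext (add_mul' _ _ _))
  let e : hK.toSubgroup ≃ K := Equiv.refl K
  have he : ∀ g h, e (g * h) = e g + e h + e g * e h := fun g h => by
    change m (e g) (e h) = e g + e h + (m (e g) (e h) - e g - e h)
    abel
  rw [← Subgroup.wellFoundedGT_subtype_iff, ← AddSubgroup.wellFoundedGT_subtype_iff]
  exact wellFoundedGT_addSubgroup_iff_adjoint he

theorem wellFoundedGT_addSubgroup_iff :
    WellFoundedGT (AddSubgroup A) ↔ WellFoundedGT (Subgroup A) := by
  have hI := isBraceIdeal_starIdeal (A := A)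
  have hJ := isBraceIdeal_opStarIdeal (A := A)
  have hK := hI.inf hJ
  have h1 := hK.wellFoundedGT_Iic_iff_of_comm fun x hx y hy => add_comm_of_mem hx.1 hy.2
  have h2 := (hK.isCommonLayer hI (Or.inr fun a ha b hb =>
    ⟨(starIdeal A).sub_mem (add_mem (neg_mem hb) (hI.mul_mem ha hb)) ha, opStar_mem a b⟩)).wellFoundedGT_Iic_iff
    inf_le_left hK.mul_conj h1
  have h3 := (hI.isCommonLayer IsBraceIdeal.top
    (Or.inl fun a _ b _ => star_mem a b)).wellFoundedGT_Iic_iff le_top hI.mul_conj h2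
  have htop : (IsBraceIdeal.top (A := A)).toSubgroup = ⊤ :=
    (Subgroup.eq_top_iff' _).2 fun x => AddSubgroup.mem_top x
  rwa [htop, AddSubgroup.wellFoundedGT_Iic_top_iff, Subgroup.wellFoundedGT_Iic_top_iff] at h3

end TwoSidedSkewBrace

theorem mainTheorem7 (A : Type*) [AddGroup A] [Group A] [IsTwoSidedSkewBrace A] :
    MaxConditionOnAddSubgroups A ↔ MaxConditionOnSubgroups A := by
  rw [maxConditionOnAddSubgroups_iff, maxConditionOnSubgroups_iff]
  exact TwoSidedSkewBrace.wellFoundedGT_addSubgroup_iff
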